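/- Fix a universal Turing machine $U$, which takes a program $p\in\{0,1\}^*$ and side information $y\in\{0,1\}^*$; universal means that for every machine (partial computable function) $M$ of two strings there is a constant $c_M$ with $K_U(x\mid y)\le K_M(x\mid y)+c_M$ for all strings $x,y$, where $K_M(x\mid y)=\min\{|p| : M(p,y)=x\}$ (and $\infty$ if there is no such $p$). Write $K(x\mid y)=K_U(x\mid y)$, $K(x)=K(x\mid\varepsilon)$, and for $t:\mathbb N\to\mathbb N$ let $K^t(x\mid y)=\min\{|p| : U(p,y)=x \text{ within at most } t(|x|) \text{ steps}\}$ (and $\infty$ if there is no such $p$). Let $R_K=\{x\in\{0,1\}^* : K(x)\ge |x|\}$ be the set of Kolmogorov-random strings, let $\overline{R_K}$ be its complement, and let $\overline{R_K}(1{:}n)\in\{0,1\}^n$ be the first $n$ bits of the characteristic sequence of $\overline{R_K}$ with respect to the length-lexicographic order of strings $\varepsilon,0,1,00,\dots$. As side information, $n$ is given in binary. Then $\overline{R_K}$ is computably enumerable, and for every computable time bound $t:\mathbb N\to\mathbb N$ there is a constant $c\ge 1$ such that for every $n$ $$K^t\bigl(\overline{R_K}(1{:}n)\mid n\bigr)\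 \ge\ n/c ,$$ except possibly for those $n<c$ for which the left-hand side is $0$ (that is, for which $U$, on the empty program and $n$, outputs $\overline{R_K}(1{:}n)$ within the time bound). In particular the inequality holds for every $n\ge c$. -/

import Mathlib

/-- Tape symbols of a Turing machine with `a` auxiliary work symbols: the blank `none`, a separator
`some none`, the two bits `some (some (Sum.inl b))`, and the work symbols. The default element of
this type, which Mathlib's tapes use as the blank, is `none`. -/
abbrev TapeSymbol (a : ℕ) : Type := Option (Option (Bool ⊕ Fin a))

namespace TapeSymbol

/-- The tape symbol for a bit. -/
def bit {a : ℕ} (b : Bool) : TapeSymbol a := some (some (Sum.inl b))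

/-- The separator between the two inputs. -/
def sep {a : ℕ} : TapeSymbol a := some none

end TapeSymbol

/-- A Turing machine with finitely many tape symbols and states: Mathlib's Post-Turing machines,
which in one step move the head by one cell or write one symbol. The start state is `0`, and the
machine halts when its transition function returns `none`. -/
structure TuringMachine where
  numAux : ℕ
  numStates : ℕ
  trans : Turing.TM0.Machine (TapeSymbol numAux) (Fin (numStates + 1))

/-- The complexity of `x` given `y` with respect to a description relation `D`, where `D p y x` says
that the program `p` with side information `y` describes `x`: the least length of such a `p`, and
`⊤` if there is none. -/
noncomputable def descComplexity (D : List Bool → List Bool → List Bool → Prop)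
    (x y : List Bool) : ℕ∞ :=
  ⨅ (p : List Bool) (_ : D p y x), (p.length : ℕ∞)

namespace TuringMachine

/-- The initial configuration on program `p` and side information `y`: the tape holds `p`, a
separator, and `y`, and the head is on the leftmost symbol of this word. -/
def start (M : TuringMachine) (p y : List Bool) :
    Turing.TM0.Cfg (TapeSymbol M.numAux) (Fin (M.numStates + 1)) :=
  Turing.TM0.init (p.map TapeSymbol.bit ++ TapeSymbol.sep :: y.map TapeSymbol.bit)

/-- `M(p, y) = x`, and the computation takes at most `T` steps: `M` halts after at most `T` steps,
and the tape from the head position on to the right consists of the bits of `x` and then blanks. -/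
def OutputsWithin (M : TuringMachine) (T : ℕ) (p y x : List Bool) : Prop :=
  ∃ c : Turing.TM0.Cfg (TapeSymbol M.numAux) (Fin (M.numStates + 1)),
    Nonempty (StateTransition.EvalsToInTime (Turing.TM0.step M.trans) (M.start p y) (some c) T) ∧
    Turing.TM0.step M.trans c = none ∧
    c.Tape.right₀ = Turing.ListBlank.mk (x.map TapeSymbol.bit)

/-- `M(p, y) = x`. -/
def Outputs (M : TuringMachine) (p y x : List Bool) : Prop :=
  ∃ T : ℕ, M.OutputsWithin T p y x

/-- The conditional Kolmogorov complexity `K_M(x | y)`. -/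
noncomputable def condK (M : TuringMachine) (x y : List Bool) : ℕ∞ :=
  descComplexity M.Outputs x y

/-- The Kolmogorov complexity `K_M(x)`, that is, `K_M(x | ε)`. -/
noncomputable def K (M : TuringMachine) (x : List Bool) : ℕ∞ := M.condK x []

/-- The time-bounded conditional complexity `K_M^t(x | y)`; the time bound is a function of the
length of the output. -/
noncomputable def condKt (M : TuringMachine) (t : ℕ → ℕ) (x y : List Bool) : ℕ∞ :=
  descComplexity (M.OutputsWithin (t x.length)) x y

/-- `U` is universal: for every machine, given as a partial computable function `f` of a program and
side information, there is a constant `c` with `K_U(x | y) ≤ K_f(x | y) + c` for all `x` and `y`. -/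
def IsUniversal (U : TuringMachine) : Prop :=
  ∀ f : List Bool → List Bool →. List Bool, Partrec₂ f →
    ∃ c : ℕ, ∀ x y : List Bool, U.condK x y ≤ descComplexity (fun p y x => x ∈ f p y) x y + c

/-- The set `R_K` of Kolmogorov-random strings. -/
def randomStrings (U : TuringMachine) : Set (List Bool) :=
  {x | (x.length : ℕ∞) ≤ U.K x}

end TuringMachine

/-- The `i`-th binary string, for `i ≥ 1`, in length-lexicographic order `ε, 0, 1, 00, 01, …`: the
binary expansion of `i`, most significant bit first, without its leading `1`. -/
def nthString (i : ℕ) : List Bool := i.bits.reverse.tail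

/-- The binary expansion of `n`, most significant bit first. -/
def binaryString (n : ℕ) : List Bool := n.bits.reverse

open scoped Classical in
/-- `A(1:n)`: the first `n` bits of the characteristic sequence of `A`. -/
noncomputable def charPrefix (A : Set (List Bool)) (n : ℕ) : List Bool :=
  (List.range n).map fun i => decide (nthString (i + 1) ∈ A)

/-!
The nonrandom strings are enumerated by running all programs (`rePred_compl_randomStrings`). For the
lower bound, the idea is that programs of length less than `n / c` which run within a computable time
bound provide a *computable* list of fewer than `2 ^ (n / c)` candidates for the prefix of length `n`
of the characteristic sequence, and that a computable list that short can be refuted by making a few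
strings nonrandom.

Let `m` be the largest length of strings that are all covered by the prefix, so that there are
`2 ^ m = Θ(n)` strings of length `m`.

* A fraction of at least `2 ^ (-e)` of these strings is random, for a constant `e`
  (`IsUniversal.exists_card_random`): some of the programs of length less than `m` are needed to
  describe shorter strings. Hence only candidates that exclude at least `2 ^ (m - e)` strings of
  length `m` from the set of nonrandom strings have to be refuted.
* A greedy choice of `2 ^ (m - O(1))` strings hits the excluded set of each of these candidates,
  since the number of candidates, taken for all `n` with the same `m`, is less than
  `2 ^ (ε * 2 ^ m)` for a small `ε`
  (`exists_hitting_list`, `exists_isHitting`).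
* Such a hitting set can be found by search, and its members are indexed by strings `q` of length
  `s = m - 2 * d - 2`. A machine that outputs the member with the index `q` on the program
  `0 ^ d 1 q` describes it with `m - d - 1` bits. When `d` is the overhead of this machine for the
  universal machine, all members are therefore nonrandom (`IsUniversal.exists_hitting_nonrandom`).
  Reading `d` off the program is what makes a fixed-point argument unnecessary.

If a short program produced the true prefix, the strings that it excludes would be exactly the random
ones, and one of them would be in the hitting set and so nonrandom, a contradiction
(`IsUniversal.linear_le_length`).

Computations of Turing machines are carried out on pairs of lists (`TuringMachine.ListCfg`) instead of
tapes, since lists are encodable. This makes the bounded simulation `TuringMachine.outTape` primitive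
recursive.
-/

/-! ### Strings and their positions in length-lexicographic order -/

/-- The position of a string in length-lexicographic order, counted from `1`: the number whose
binary expansion is the string preceded by a `1`. It inverts `nthString`. -/
def strIndex (x : List Bool) : ℕ := x.foldl (fun v b => Nat.bit b v) 1

theorem strIndex_append_singleton (x : List Bool) (b : Bool) :
    strIndex (x ++ [b]) = Nat.bit b (strIndex x) := by
  simp [strIndex, List.foldl_append]

theorem nthString_bit (b : Bool) {n : ℕ} (hn : n ≠ 0) :
    nthString (Nat.bit b n) = nthString n ++ [b] := by
  have h : n.bits.reverse ≠ [] := by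
    intro h
    have := Nat.size_eq_bits_len n
    rw [List.reverse_eq_nil_iff.mp h] at this
    exact hn (Nat.size_eq_zero.mp this.symm)
  simp only [nthString]
  rw [Nat.bits_append_bit n b (fun h0 => absurd h0 hn), List.reverse_cons,
    List.tail_append_of_ne_nil h]

theorem strIndex_ne_zero (x : List Bool) : strIndex x ≠ 0 := by
  induction x using List.reverseRecOn with
  | nil => simp [strIndex]
  | append_singleton x b ih =>
    rw [strIndex_append_singleton]
    exact fun h => ih (Nat.bit_eq_zero_iff.mp h).1

theorem nthString_strIndex (x : List Bool) : nthString (strIndex x) = x := by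
  induction x using List.reverseRecOn with
  | nil => simp [strIndex, nthString]
  | append_singleton x b ih =>
    rw [strIndex_append_singleton, nthString_bit b (strIndex_ne_zero x), ih]

theorem strIndex_nthString {n : ℕ} (hn : n ≠ 0) : strIndex (nthString n) = n := by
  induction n using Nat.binaryRec' with
  | zero => exact absurd rfl hn
  | bit b n h ih =>
    rcases Nat.eq_zero_or_pos n with rfl | h0
    · simp [h rfl, nthString, strIndex]
    · rw [nthString_bit b h0.ne', strIndex_append_singleton, ih h0.ne']

theorem nthString_injective {a b : ℕ} (ha : a ≠ 0) (hb : b ≠ 0) (h : nthString a = nthString b) :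
    a = b := by
  rw [← strIndex_nthString ha, h, strIndex_nthString hb]

theorem two_pow_length_le_strIndex (x : List Bool) : 2 ^ x.length ≤ strIndex x := by
  induction x using List.reverseRecOn with
  | nil => simp [strIndex]
  | append_singleton x b ih =>
    rw [strIndex_append_singleton, Nat.bit_val, List.length_append, List.length_singleton, pow_succ]
    omega

theorem strIndex_lt_two_pow (x : List Bool) : strIndex x < 2 ^ (x.length + 1) := by
  induction x using List.reverseRecOn with
  | nil => simp [strIndex]
  | append_singleton x b ih =>
    rw [strIndex_append_singleton, Nat.bit_val, List.length_append, List.length_singleton,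
      pow_succ _ (x.length + 1)]
    have := Bool.toNat_lt b
    omega

theorem length_nthString {m n : ℕ} (h₁ : 2 ^ m ≤ n) (h₂ : n < 2 ^ (m + 1)) :
    (nthString n).length = m := by
  have hn : n ≠ 0 := by have := Nat.two_pow_pos m; omega
  have h₃ := two_pow_length_le_strIndex (nthString n)
  have h₄ := strIndex_lt_two_pow (nthString n)
  rw [strIndex_nthString hn] at h₃ h₄
  have := (Nat.pow_lt_pow_iff_right (by norm_num : 1 < 2)).mp (h₃.trans_lt h₂)
  have := (Nat.pow_lt_pow_iff_right (by norm_num : 1 < 2)).mp (h₁.trans_lt h₄)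
  omega

theorem le_length_nthString {m n : ℕ} (h : 2 ^ m ≤ n) : m ≤ (nthString n).length := by
  have hn : n ≠ 0 := by have := Nat.two_pow_pos m; omega
  have h₄ := strIndex_lt_two_pow (nthString n)
  rw [strIndex_nthString hn] at h₄
  have := (Nat.pow_lt_pow_iff_right (by norm_num : 1 < 2)).mp (h.trans_lt h₄)
  omega

theorem primrec_two_pow : Primrec fun n : ℕ => 2 ^ n :=
  (Primrec.nat_rec₁ 1 (Primrec.nat_double.comp Primrec.snd).to₂).of_eq fun n => by
    induction n with
    | zero => rfl
    | succ n ih => rw [pow_succ, mul_comm, ← ih]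

/-- Moving the last binary digit of a number to the front of a list of digits. Iterating it turns a
number into its binary expansion. -/
def shiftDigit (s : ℕ × List Bool) : ℕ × List Bool :=
  if s.1 = 0 then s else (s.1.div2, s.1.bodd :: s.2)

theorem iterate_shiftDigit (k n : ℕ) (l : List Bool) (h : n ≤ k) :
    shiftDigit^[k] (n, l) = (0, n.bits.reverse ++ l) := by
  induction k generalizing n l with
  | zero => obtain rfl : n = 0 := by omega
            simp
  | succ k ih =>
    rw [Function.iterate_succ_apply]
    rcases Nat.eq_zero_or_pos n with rfl | h0
    · simpa [shiftDigit] using ih 0 l (Nat.zero_le k)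
    · have hb : n.bits = n.bodd :: n.div2.bits := by
        conv_lhs => rw [← Nat.bit_bodd_div2 n]
        apply Nat.bits_append_bit
        intro h2
        have := Nat.bodd_add_div2 n
        cases hbo : n.bodd <;> simp_all
      have : n.div2 ≤ k := by rw [Nat.div2_val]; omega
      rw [shiftDigit, if_neg h0.ne', ih _ _ this, hb]
      simp

theorem primrec_shiftDigit : Primrec shiftDigit :=
  Primrec.ite (Primrec.eq.comp Primrec.fst (Primrec.const 0)) Primrec.id
    ((Primrec.nat_div2.comp Primrec.fst).pair
      (Primrec.list_cons.comp (Primrec.nat_bodd.comp Primrec.fst) Primrec.snd))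

theorem primrec_binaryString : Primrec binaryString :=
  (Primrec.snd.comp (Primrec.nat_iterate (f := fun n : ℕ => n)
    (g := fun n : ℕ => (n, ([] : List Bool))) (h := fun _ s => shiftDigit s)
    Primrec.id (Primrec.id.pair (Primrec.const []))
    (primrec_shiftDigit.comp Primrec.snd).to₂)).of_eq fun n => by
      simp [iterate_shiftDigit n n [] le_rfl, binaryString]

theorem primrec_nthString : Primrec nthString :=
  Primrec.list_tail.comp primrec_binaryString

theorem primrec_bit : Primrec₂ Nat.bit :=
  (Primrec.cond Primrec.fst (Primrec.nat_double_succ.comp Primrec.snd)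
    (Primrec.nat_double.comp Primrec.snd)).of_eq fun ⟨b, n⟩ => by cases b <;> rfl

theorem primrec_strIndex : Primrec strIndex :=
  Primrec.list_foldl Primrec.id (Primrec.const 1)
    (primrec_bit.comp (Primrec.snd.comp Primrec.snd) (Primrec.fst.comp Primrec.snd)).to₂

/-! ### Hitting sets for families of dense sets -/

/-- If every set of the family `C` has at least `N / (a + 1)` of the numbers below `N`, then some
number below `N` lies in at least a fraction `1 / (a + 1)` of the sets. -/
theorem exists_mem_many {N a : ℕ} (hN : 0 < N) (C : List (Finset ℕ))
    (hsub : ∀ Z ∈ C, Z ⊆ Finset.range N) (hC : ∀ Z ∈ C, N ≤ (a + 1) * Z.card) :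
    ∃ i, C.length ≤ (a + 1) * C.countP (i ∈ ·) := by
  have hsum : ∑ i ∈ Finset.range N, C.countP (i ∈ ·) = (C.map Finset.card).sum := by
    clear hC
    induction C with
    | nil => simp
    | cons Z C ih =>
      simp only [List.countP_cons, Finset.sum_add_distrib, List.map_cons, List.sum_cons]
      rw [ih fun Z hZ => hsub Z (List.mem_cons_of_mem _ hZ)]
      have : Finset.range N ∩ Z = Z := Finset.inter_eq_right.mpr (hsub Z List.mem_cons_self)
      simp [this, add_comm]
  have hle : C.length * N ≤ (a + 1) * (C.map Finset.card).sum := by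
    clear hsum hsub
    induction C with
    | nil => simp
    | cons Z C ih =>
      have h₁ := hC Z List.mem_cons_self
      have h₂ := ih fun Z hZ => hC Z (List.mem_cons_of_mem _ hZ)
      simp only [List.length_cons, List.map_cons, List.sum_cons]
      rw [add_mul, mul_add]
      omega
  by_contra! hlt
  have : ∑ i ∈ Finset.range N, (a + 1) * C.countP (i ∈ ·) < ∑ _i ∈ Finset.range N, C.length :=
    Finset.sum_lt_sum_of_nonempty (Finset.nonempty_range_iff.mpr hN.ne') fun i _ => hlt i
  rw [← Finset.mul_sum, hsum, Finset.sum_const, Finset.card_range, smul_eq_mul, mul_comm N] at this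
  omega

/-- A greedy choice of `k` numbers hits every set of a family of sets of density `1 / (a + 1)`,
provided that the family has fewer than `((a + 1) / a) ^ k` members. -/
theorem exists_hitting_list {N a : ℕ} (hN : 0 < N) (k : ℕ) (C : List (Finset ℕ))
    (hsub : ∀ Z ∈ C, Z ⊆ Finset.range N) (hC : ∀ Z ∈ C, N ≤ (a + 1) * Z.card)
    (hcard : C.length * a ^ k < (a + 1) ^ k) :
    ∃ X : List ℕ, X.length ≤ k ∧ ∀ Z ∈ C, ∃ i ∈ Z, i ∈ X := by
  induction k generalizing C with
  | zero =>
    have : C = [] := by simpa using hcard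
    exact ⟨[], le_rfl, by simp [this]⟩
  | succ k ih =>
    obtain ⟨i, hi⟩ := exists_mem_many hN C hsub hC
    -- the sets that are missed by `i`
    set C' := C.filter (fun Z => ¬ i ∈ Z) with hC'
    have hlen : C.length = C.countP (i ∈ ·) + C'.length := by
      rw [hC', ← List.countP_eq_length_filter, List.length_eq_countP_add_countP (i ∈ ·)]
      simp
    have hshrink : (a + 1) * C'.length ≤ a * C.length := by nlinarith
    obtain ⟨X, hX, hhit⟩ := ih C' (fun Z hZ => hsub Z (List.mem_of_mem_filter hZ))
      (fun Z hZ => hC Z (List.mem_of_mem_filter hZ)) (by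
        refine lt_of_mul_lt_mul_left (a := a + 1) ?_ (Nat.zero_le _)
        calc (a + 1) * (C'.length * a ^ k) = ((a + 1) * C'.length) * a ^ k := by ring
          _ ≤ (a * C.length) * a ^ k := Nat.mul_le_mul_right _ hshrink
          _ = C.length * a ^ (k + 1) := by ring
          _ < (a + 1) ^ (k + 1) := hcard
          _ = (a + 1) * (a + 1) ^ k := by ring)
    refine ⟨i :: X, by simpa using hX, fun Z hZ => ?_⟩
    by_cases hiZ : i ∈ Z
    · exact ⟨i, hiZ, List.mem_cons_self⟩
    · obtain ⟨j, hj, hjX⟩ := hhit Z (by simp [hC', hZ, hiZ])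
      exact ⟨j, hj, List.mem_cons_of_mem _ hjX⟩

theorem pow_mul_add_le (a n : ℕ) : a ^ n * (a + n) ≤ a * (a + 1) ^ n := by
  induction n with
  | zero => simp
  | succ n ih =>
    calc a ^ (n + 1) * (a + (n + 1)) = a ^ n * (a * (a + n + 1)) := by ring
      _ ≤ a ^ n * ((a + n) * (a + 1)) := Nat.mul_le_mul_left _ (by nlinarith)
      _ = (a ^ n * (a + n)) * (a + 1) := by ring
      _ ≤ (a * (a + 1) ^ n) * (a + 1) := Nat.mul_le_mul_right _ ih
      _ = a * (a + 1) ^ (n + 1) := by ring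

/-- The inequality `(1 + 1 / a) ^ (a + 1) ≥ 2`. -/
theorem two_mul_pow_le (a : ℕ) : 2 * a ^ (a + 1) ≤ (a + 1) ^ (a + 1) := by
  rcases Nat.eq_zero_or_pos a with rfl | ha
  · simp
  · refine Nat.le_of_mul_le_mul_left ?_ ha
    calc a * (2 * a ^ (a + 1)) = a ^ (a + 1) * (2 * a) := by ring
      _ ≤ a ^ (a + 1) * (a + (a + 1)) := Nat.mul_le_mul_left _ (by omega)
      _ ≤ a * (a + 1) ^ (a + 1) := pow_mul_add_le a (a + 1)

theorem two_pow_mul_pow_lt {e s r : ℕ} (he : 1 ≤ e) (hs : e ≤ s) (hr : r < 2 ^ (s - e)) :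
    2 ^ r * (2 ^ e - 1) ^ 2 ^ s < (2 ^ e) ^ 2 ^ s := by
  obtain ⟨a, ha⟩ : ∃ a, 2 ^ e = a + 1 := ⟨2 ^ e - 1, by have := Nat.two_pow_pos e; omega⟩
  have ha0 : 0 < a := by
    have : 2 ^ 1 ≤ 2 ^ e := Nat.pow_le_pow_right (by norm_num) he
    omega
  have hse : 2 ^ s = (a + 1) * 2 ^ (s - e) := by rw [← ha, ← pow_add]; congr 1; omega
  rw [hse, ha, Nat.add_sub_cancel, pow_mul, pow_mul]
  calc 2 ^ r * (a ^ (a + 1)) ^ 2 ^ (s - e) < 2 ^ 2 ^ (s - e) * (a ^ (a + 1)) ^ 2 ^ (s - e) :=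
        Nat.mul_lt_mul_of_pos_right (Nat.pow_lt_pow_right (by norm_num) hr) (by positivity)
    _ = (2 * a ^ (a + 1)) ^ 2 ^ (s - e) := (mul_pow _ _ _).symm
    _ ≤ ((a + 1) ^ (a + 1)) ^ 2 ^ (s - e) := Nat.pow_le_pow_left (two_mul_pow_le a) _

theorem add_lt_two_pow {b j : ℕ} (h : b + 1 ≤ j) : j + b < 2 ^ j := by
  induction j, h using Nat.le_induction with
  | base => have := Nat.lt_two_pow_self (n := b); rw [pow_succ]; omega
  | succ j _ ih => rw [pow_succ]; omega

/-! ### Simulation of Turing machines on lists -/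

/-- A partial function evaluated by repeated steps: the evaluation of `f` from `a` halts in `c`
within `T` steps exactly if iterating `f` for `T` steps, staying put where `f` is undefined, ends in
the halting configuration `c`. -/
theorem nonempty_evalsToInTime_iff {σ : Type*} (f : σ → Option σ) (T : ℕ) (a c : σ) :
    (Nonempty (StateTransition.EvalsToInTime f a (some c) T) ∧ f c = none) ↔
      ((fun b => (f b).getD b)^[T] a = c ∧ f c = none) := by
  have key : (∃ k ≤ T, (flip bind f)^[k] (some a) = some c) ∧ f c = none ↔
      ((fun b => (f b).getD b)^[T] a = c ∧ f c = none) := by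
    refine and_congr_left fun hc => ?_
    induction T generalizing a with
    | zero => simp
    | succ T ih =>
      rw [Function.iterate_succ_apply]
      cases hfa : f a with
      | none =>
        have hstay : (fun b => (f b).getD b)^[T] a = a := by
          apply Function.iterate_fixed
          simp [hfa]
        have hnone : ∀ k, (flip bind f)^[k] none = none := fun k => by
          apply Function.iterate_fixed
          rfl
        rw [Option.getD_none, hstay]
        constructor
        · rintro ⟨k, -, hk⟩
          cases k with
          | zero => simpa using hk
          | succ k =>
            have : flip bind f (some a) = none := hfa
            rw [Function.iterate_succ_apply, this, hnone] at hk
            cases hk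
        · rintro rfl
          exact ⟨0, Nat.zero_le _, rfl⟩
      | some b =>
        rw [Option.getD_some, ← ih]
        have hb : flip bind f (some a) = some b := hfa
        constructor
        · rintro ⟨k, hk, h⟩
          cases k with
          | zero =>
            obtain rfl : a = c := by simpa using h
            rw [hc] at hfa
            cases hfa
          | succ k =>
            rw [Function.iterate_succ_apply, hb] at h
            exact ⟨k, by omega, h⟩
        · rintro ⟨k, hk, h⟩
          exact ⟨k + 1, by omega, by rw [Function.iterate_succ_apply, hb, h]⟩
  rw [← key]
  refine and_congr_left fun _ => ⟨fun ⟨h⟩ => ⟨h.steps, h.steps_le_m, h.evals_in_steps⟩, ?_⟩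
  rintro ⟨k, hk, h⟩
  exact ⟨⟨⟨k, h⟩, hk⟩⟩

/-- Two lists denote the same half-tape exactly if they agree once each is padded with blanks by the
length of the other. -/
theorem listBlank_mk_eq_iff {Γ : Type*} [Inhabited Γ] (l₁ l₂ : List Γ) :
    Turing.ListBlank.mk l₁ = Turing.ListBlank.mk l₂ ↔
      l₁ ++ l₂.map (fun _ => default) = l₂ ++ l₁.map (fun _ => default) := by
  have hpad : ∀ l l' : List Γ,
      Turing.ListBlank.mk (l ++ l'.map fun _ => default) = Turing.ListBlank.mk l := by
    intro l l'
    refine (Quotient.sound' (Or.inl ⟨l'.length, ?_⟩)).symm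
    simp
  constructor
  · intro h
    have hn : ∀ i, l₁.getI i = l₂.getI i := fun i => by
      rw [← Turing.ListBlank.nth_mk, h, Turing.ListBlank.nth_mk]
    have hget : ∀ (l l' : List Γ) (i : ℕ), (l ++ l'.map fun _ => default).getI i = l.getI i :=
      fun l l' i => by rw [← Turing.ListBlank.nth_mk, hpad, Turing.ListBlank.nth_mk]
    refine List.ext_getElem (by simp [add_comm]) fun i h₁ h₂ => ?_
    rw [← List.getI_eq_getElem _ h₁, ← List.getI_eq_getElem _ h₂, hget, hget, hn]
  · intro h
    rw [← hpad l₁ l₂, h, hpad]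

theorem primrecRel_listBlank_mk_eq {Γ : Type*} [Inhabited Γ] [Primcodable Γ] :
    PrimrecRel fun l₁ l₂ : List Γ => Turing.ListBlank.mk l₁ = Turing.ListBlank.mk l₂ := by
  have hb : Primrec fun l : List Γ => l.map fun _ => (default : Γ) :=
    Primrec.list_map Primrec.id (Primrec.const default).to₂
  have h : PrimrecRel fun l₁ l₂ : List Γ =>
      l₁ ++ l₂.map (fun _ => default) = l₂ ++ l₁.map (fun _ => default) :=
    Primrec.eq.comp (Primrec.list_append.comp Primrec.fst (hb.comp Primrec.snd))
      (Primrec.list_append.comp Primrec.snd (hb.comp Primrec.fst))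
  exact h.of_eq fun l₁ l₂ => (listBlank_mk_eq_iff l₁ l₂).symm

theorem TapeSymbol.bit_injective {a : ℕ} : Function.Injective (TapeSymbol.bit (a := a)) :=
  fun b c h => by simpa [TapeSymbol.bit] using h

theorem TapeSymbol.bit_ne_default {a : ℕ} (b : Bool) : TapeSymbol.bit (a := a) b ≠ default :=
  Option.some_ne_none _

/-- Bits are not blank, so that the symbols of a half-tape that holds `x` locate the bits of `x`. -/
theorem getI_eq_bit_iff {a : ℕ} {l : List (TapeSymbol a)} {x : List Bool}
    (h : Turing.ListBlank.mk l = Turing.ListBlank.mk (x.map TapeSymbol.bit)) (i : ℕ) (b : Bool) :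
    l.getI i = TapeSymbol.bit b ↔ x[i]? = some b := by
  rw [← Turing.ListBlank.nth_mk, h, Turing.ListBlank.nth_mk]
  rcases lt_or_ge i x.length with hi | hi
  · rw [List.getI_eq_getElem _ (by simpa using hi)]
    simp [hi, TapeSymbol.bit_injective.eq_iff]
  · rw [List.getI_eq_default _ (by simpa using hi), List.getElem?_eq_none hi]
    simpa using (TapeSymbol.bit_ne_default b).symm

namespace TuringMachine

variable (M : TuringMachine)

/-- A configuration with the two half-tapes given by lists: the state, the cells to the left of the
head, and the cells from the head position on to the right. -/
abbrev ListCfg : Type :=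
  Fin (M.numStates + 1) × List (TapeSymbol M.numAux) × List (TapeSymbol M.numAux)

/-- The configuration denoted by a list configuration. -/
def ListCfg.toCfg {M : TuringMachine} (c : M.ListCfg) :
    Turing.TM0.Cfg (TapeSymbol M.numAux) (Fin (M.numStates + 1)) :=
  ⟨c.1, Turing.Tape.mk' (Turing.ListBlank.mk c.2.1) (Turing.ListBlank.mk c.2.2)⟩

/-- The transition function as a function on encodable types: `Sum.inl a` writes `a`,
and `Sum.inr b` moves the head to the left if `b` holds and to the right otherwise. -/
def listTrans (c : Fin (M.numStates + 1) × TapeSymbol M.numAux) :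
    Option (Fin (M.numStates + 1) × (TapeSymbol M.numAux ⊕ Bool)) :=
  (M.trans c.1 c.2).map fun r => (r.1, match r.2 with
    | .write a => .inl a
    | .move .left => .inr true
    | .move .right => .inr false)

/-- One step of `M` on list configurations. -/
def listStep (c : M.ListCfg) : Option M.ListCfg :=
  (M.listTrans (c.1, c.2.2.headI)).map fun r => (r.1,
    Sum.casesOn r.2 (fun a => (c.2.1, a :: c.2.2.tail)) fun b =>
      bif b then (c.2.1.tail, c.2.1.headI :: c.2.2) else (c.2.2.headI :: c.2.1, c.2.2.tail))

theorem step_toCfg (c : M.ListCfg) :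
    Turing.TM0.step M.trans c.toCfg = (M.listStep c).map ListCfg.toCfg := by
  obtain ⟨q, l, r⟩ := c
  simp only [Turing.TM0.step, ListCfg.toCfg, listStep, listTrans, Option.map_map,
    Turing.Tape.mk'_head, Turing.ListBlank.head_mk]
  refine congrArg (Option.map · _) (funext fun ⟨q', s⟩ => ?_)
  rcases s with (_ | _) | a <;>
    simp [Turing.Tape.move_left_mk', Turing.Tape.move_right_mk', Turing.Tape.write_mk',
        ListCfg.toCfg]

/-- The list configuration after `T` steps on program `p` and side information `y`, or the halting
configuration if there is one earlier. -/
def listRun (T : ℕ) (p y : List Bool) : M.ListCfg :=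
  (fun c => (M.listStep c).getD c)^[T]
    (0, [], p.map TapeSymbol.bit ++ TapeSymbol.sep :: y.map TapeSymbol.bit)

/-- The half-tape from the head position on to the right, if `M` halts within `T` steps. -/
def outTape (T : ℕ) (p y : List Bool) : Option (List (TapeSymbol M.numAux)) :=
  if M.listStep (M.listRun T p y) = none then some (M.listRun T p y).2.2 else none

theorem toCfg_listRun (T : ℕ) (p y : List Bool) :
    (fun c => (Turing.TM0.step M.trans c).getD c)^[T] (M.start p y) =
      (M.listRun T p y).toCfg := by
  have hsemi : Function.Semiconj (ListCfg.toCfg (M := M)) (fun c => (M.listStep c).getD c)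
      (fun c => (Turing.TM0.step M.trans c).getD c) := fun c => by
    simp only [step_toCfg]
    cases M.listStep c <;> rfl
  rw [listRun, (hsemi.iterate_right T).eq]
  rfl

theorem outputsWithin_iff (T : ℕ) (p y x : List Bool) :
    M.OutputsWithin T p y x ↔ ∃ l, M.outTape T p y = some l ∧
      Turing.ListBlank.mk l = Turing.ListBlank.mk (x.map TapeSymbol.bit) := by
  have hstep : Turing.TM0.step M.trans (M.listRun T p y).toCfg = none ↔
      M.listStep (M.listRun T p y) = none := by
    rw [step_toCfg, Option.map_eq_none_iff]
  have hright : (M.listRun T p y).toCfg.Tape.right₀ = Turing.ListBlank.mk (M.listRun T p y).2.2 :=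
    Turing.Tape.mk'_right₀ _ _
  simp only [OutputsWithin, ← and_assoc, nonempty_evalsToInTime_iff, toCfg_listRun]
  simp only [and_assoc, exists_eq_left', hstep, hright, outTape]
  split_ifs with h <;> simp [h]

theorem OutputsWithin.mono {M : TuringMachine} {T T' : ℕ} {p y x : List Bool}
    (h : M.OutputsWithin T p y x) (hT : T ≤ T') : M.OutputsWithin T' p y x := by
  obtain ⟨c, ⟨e⟩, hc⟩ := h
  exact ⟨c, ⟨⟨e.toEvalsTo, e.steps_le_m.trans hT⟩⟩, hc⟩

theorem Outputs.unique {M : TuringMachine} {p y x x' : List Bool}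
    (h : M.Outputs p y x) (h' : M.Outputs p y x') : x = x' := by
  obtain ⟨T, hT⟩ := h
  obtain ⟨T', hT'⟩ := h'
  obtain ⟨l, hl, hx⟩ := (M.outputsWithin_iff _ _ _ _).mp (hT.mono (le_max_left T T'))
  obtain ⟨l', hl', hx'⟩ := (M.outputsWithin_iff _ _ _ _).mp (hT'.mono (le_max_right T T'))
  obtain rfl : l = l' := Option.some_injective _ (hl.symm.trans hl')
  exact List.ext_getElem? fun i => Option.ext fun b => by
    rw [← getI_eq_bit_iff hx, ← getI_eq_bit_iff hx']

theorem primrec_map_bit {a : ℕ} :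
    Primrec fun x : List Bool => x.map (TapeSymbol.bit (a := a)) :=
  Primrec.list_map Primrec.id ((Primrec.dom_finite TapeSymbol.bit).comp Primrec.snd).to₂

theorem primrec_listStep : Primrec M.listStep := by
  have hl : Primrec fun c : M.ListCfg × (Fin (M.numStates + 1) × (TapeSymbol M.numAux ⊕ Bool)) =>
      c.1.2.1 := Primrec.fst.comp (Primrec.snd.comp Primrec.fst)
  have hr : Primrec fun c : M.ListCfg × (Fin (M.numStates + 1) × (TapeSymbol M.numAux ⊕ Bool)) =>
      c.1.2.2 := Primrec.snd.comp (Primrec.snd.comp Primrec.fst)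
  refine Primrec.option_map ((Primrec.dom_finite M.listTrans).comp
    (Primrec.fst.pair (Primrec.list_headI.comp (Primrec.snd.comp Primrec.snd)))) ?_
  refine Primrec.pair (Primrec.fst.comp Primrec.snd) ?_
  refine Primrec.sumCasesOn (Primrec.snd.comp Primrec.snd) ?_ ?_
  · exact (hl.comp Primrec.fst).pair
      (Primrec.list_cons.comp Primrec.snd (Primrec.list_tail.comp (hr.comp Primrec.fst)))
  · refine Primrec.cond Primrec.snd (Primrec.pair ?_ ?_) (Primrec.pair ?_ ?_)
    · exact Primrec.list_tail.comp (hl.comp Primrec.fst)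
    · exact Primrec.list_cons.comp (Primrec.list_headI.comp (hl.comp Primrec.fst))
        (hr.comp Primrec.fst)
    · exact Primrec.list_cons.comp (Primrec.list_headI.comp (hr.comp Primrec.fst))
        (hl.comp Primrec.fst)
    · exact Primrec.list_tail.comp (hr.comp Primrec.fst)

theorem primrec_listRun :
    Primrec fun a : ℕ × List Bool × List Bool => M.listRun a.1 a.2.1 a.2.2 := by
  refine Primrec.nat_iterate Primrec.fst ?_ ?_
  · refine (Primrec.const 0).pair ((Primrec.const []).pair (Primrec.list_append.comp
      (primrec_map_bit.comp (Primrec.fst.comp Primrec.snd)) ?_))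
    exact Primrec.list_cons.comp (Primrec.const _)
      (primrec_map_bit.comp (Primrec.snd.comp Primrec.snd))
  · exact (Primrec.option_getD.comp (M.primrec_listStep.comp Primrec.snd) Primrec.snd).to₂

theorem primrec_outTape :
    Primrec fun a : ℕ × List Bool × List Bool => M.outTape a.1 a.2.1 a.2.2 :=
  Primrec.ite (Primrec.eq.comp (M.primrec_listStep.comp M.primrec_listRun) (Primrec.const none))
    (Primrec.option_some.comp (Primrec.snd.comp (Primrec.snd.comp M.primrec_listRun)))
    (Primrec.const none)

end TuringMachine

/-! ### Random strings of a universal machine -/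

theorem descComplexity_lt_iff {D : List Bool → List Bool → List Bool → Prop} {x y : List Bool}
    {k : ℕ∞} : descComplexity D x y < k ↔ ∃ p, D p y x ∧ (p.length : ℕ∞) < k := by
  simp [descComplexity, iInf_lt_iff]

namespace TuringMachine

variable {U : TuringMachine}

theorem mem_compl_randomStrings_iff {x : List Bool} :
    x ∈ U.randomStringsᶜ ↔ ∃ p, U.Outputs p [] x ∧ p.length < x.length := by
  simp only [randomStrings, Set.mem_compl_iff, Set.mem_ofPred_eq, not_le, K, condK,
    descComplexity_lt_iff, Nat.cast_lt]

/-- A universal machine turns the programs of any partial computable function into programs of its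
own that are longer by at most a constant. -/
theorem IsUniversal.exists_program (hU : U.IsUniversal) {f : List Bool → List Bool →. List Bool}
    (hf : Partrec₂ f) :
    ∃ c, ∀ p x, x ∈ f p [] → ∃ p', U.Outputs p' [] x ∧ p'.length ≤ p.length + c := by
  obtain ⟨c, hc⟩ := hU f hf
  refine ⟨c, fun p x hx => ?_⟩
  have h : U.condK x [] < ((p.length + c + 1 : ℕ) : ℕ∞) := by
    refine (hc x []).trans_lt (lt_of_le_of_lt (b := ((p.length + c : ℕ) : ℕ∞)) ?_ ?_)
    · push_cast
      gcongr
      exact iInf₂_le p hx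
    · exact_mod_cast Nat.lt_succ_self _
  obtain ⟨p', hp', hlen⟩ := descComplexity_lt_iff.mp h
  exact ⟨p', hp', by have := Nat.cast_lt.mp hlen; omega⟩

/-- There are fewer than `2 ^ m` programs of length less than `m`, and each describes at most one
string. -/
theorem card_le_of_short_programs {m : ℕ} (S : Finset ℕ) (h0 : 0 ∉ S)
    (hS : ∀ k ∈ S, ∃ p, U.Outputs p [] (nthString k) ∧ p.length < m) : S.card ≤ 2 ^ m := by
  choose! P hP hlen using hS
  rw [← Finset.card_range (2 ^ m)]
  refine Finset.card_le_card_of_injOn (fun k => strIndex (P k)) (fun k hk => ?_) ?_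
  · rw [Finset.coe_range, Set.mem_Iio]
    exact (strIndex_lt_two_pow _).trans_le (Nat.pow_le_pow_right (by norm_num) (hlen k hk))
  · intro k hk j hj hkj
    have hPP : P k = P j := by
      rw [← nthString_strIndex (P k), show strIndex (P k) = strIndex (P j) from hkj,
        nthString_strIndex]
    have := (hP k hk).unique (hPP ▸ hP j hj)
    exact nthString_injective (fun h => h0 (h ▸ hk)) (fun h => h0 (h ▸ hj)) this

open scoped Classical in
/-- A constant fraction of the strings of each length is random: the programs of length less than `m`
also have to describe all strings of length `m - 1 - g`, where `g` is the overhead for copying the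
program to the output. -/
theorem IsUniversal.exists_card_random (hU : U.IsUniversal) :
    ∃ e, 1 ≤ e ∧ ∀ m, e ≤ m → 2 ^ m ≤ 2 ^ e *
      ((Finset.range (2 ^ m)).filter fun i => nthString (2 ^ m + i) ∈ U.randomStrings).card := by
  obtain ⟨g, hg⟩ := hU.exists_program (f := fun p _ => Part.some p) Computable.fst.partrec
  refine ⟨g + 1, by omega, fun m hm => ?_⟩
  set R := (Finset.range (2 ^ m)).filter fun i => nthString (2 ^ m + i) ∈ U.randomStrings
  set N := (Finset.range (2 ^ m)).filter fun i => ¬ nthString (2 ^ m + i) ∈ U.randomStrings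
  have hRN : R.card + N.card = 2 ^ m := by
    rw [Finset.card_filter_add_card_filter_not, Finset.card_range]
  -- The strings of length `k` have programs of length at most `k + g < m`.
  obtain ⟨k, rfl⟩ : ∃ k, m = k + (g + 1) := ⟨m - (g + 1), by omega⟩
  have hk : 2 ^ k * 2 ≤ 2 ^ (k + (g + 1)) := by
    rw [← pow_succ]; exact Nat.pow_le_pow_right (by norm_num) (by omega)
  have hdisj : Disjoint (N.map (addLeftEmbedding (2 ^ (k + (g + 1)))))
      (Finset.Ico (2 ^ k) (2 ^ (k + 1))) := by
    rw [Finset.disjoint_left]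
    intro i hi hi'
    obtain ⟨j, -, rfl⟩ := Finset.mem_map.mp hi
    have := (Finset.mem_Ico.mp hi').2
    rw [pow_succ] at this
    simp only [addLeftEmbedding_apply] at this
    omega
  have hcard := card_le_of_short_programs (U := U) (m := k + (g + 1))
    (N.map (addLeftEmbedding (2 ^ (k + (g + 1)))) ∪ Finset.Ico (2 ^ k) (2 ^ (k + 1)))
    (by simp) (by
      intro i hi
      rcases Finset.mem_union.mp hi with hi | hi
      · obtain ⟨j, hj, rfl⟩ := Finset.mem_map.mp hi
        obtain ⟨hj₁, hj₂⟩ := Finset.mem_filter.mp hj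
        obtain ⟨p, hp, hlen⟩ := mem_compl_randomStrings_iff.mp hj₂
        have hj₁ := Finset.mem_range.mp hj₁
        rw [length_nthString (m := k + (g + 1)) (by omega) (by rw [pow_succ]; omega)] at hlen
        exact ⟨p, hp, hlen⟩
      · obtain ⟨hi₁, hi₂⟩ := Finset.mem_Ico.mp hi
        obtain ⟨p, hp, hlen⟩ := hg (nthString i) (nthString i) (Part.mem_some _)
        rw [length_nthString hi₁ hi₂] at hlen
        exact ⟨p, hp, by omega⟩)
  rw [Finset.card_union_of_disjoint hdisj, Finset.card_map, Nat.card_Ico, pow_succ 2 k] at hcard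
  have hR : 2 ^ k ≤ R.card := by omega
  calc 2 ^ (k + (g + 1)) = 2 ^ (g + 1) * 2 ^ k := by rw [pow_add, mul_comm]
    _ ≤ 2 ^ (g + 1) * R.card := Nat.mul_le_mul_left _ hR

theorem primrecPred_outputsWithin (U : TuringMachine) :
    PrimrecPred fun a : ℕ × List Bool × List Bool × List Bool =>
      U.OutputsWithin a.1 a.2.1 a.2.2.1 a.2.2.2 := by
  have hout : Primrec fun a : ℕ × List Bool × List Bool × List Bool =>
      U.outTape a.1 a.2.1 a.2.2.1 :=
    U.primrec_outTape.comp (Primrec.fst.pair ((Primrec.fst.comp Primrec.snd).pair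
      (Primrec.fst.comp (Primrec.snd.comp Primrec.snd))))
  have h₁ : PrimrecPred fun a : ℕ × List Bool × List Bool × List Bool =>
      (U.outTape a.1 a.2.1 a.2.2.1).isSome = true :=
    Primrec.eq.comp (Primrec.option_isSome.comp hout) (Primrec.const true)
  have h₂ : PrimrecPred fun a : ℕ × List Bool × List Bool × List Bool =>
      Turing.ListBlank.mk ((U.outTape a.1 a.2.1 a.2.2.1).getD []) =
        Turing.ListBlank.mk (a.2.2.2.map TapeSymbol.bit) :=
    primrecRel_listBlank_mk_eq.comp (Primrec.option_getD.comp hout (Primrec.const []))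
      (primrec_map_bit.comp (Primrec.snd.comp (Primrec.snd.comp Primrec.snd)))
  refine (h₁.and h₂).of_eq fun a => ?_
  rw [outputsWithin_iff]
  cases U.outTape a.1 a.2.1 a.2.2.1 <;> simp

theorem rePred_compl_randomStrings (U : TuringMachine) :
    REPred fun x : List Bool => x ∈ U.randomStringsᶜ := by
  classical
  have hp : Primrec fun a : List Bool × ℕ => nthString a.2.unpair.1 :=
    primrec_nthString.comp (Primrec.fst.comp (Primrec.unpair.comp Primrec.snd))
  have hP : PrimrecPred fun a : List Bool × ℕ =>
      U.OutputsWithin a.2.unpair.2 (nthString a.2.unpair.1) [] a.1 ∧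
        (nthString a.2.unpair.1).length < a.1.length :=
    (U.primrecPred_outputsWithin.comp ((Primrec.snd.comp (Primrec.unpair.comp Primrec.snd)).pair
      (hp.pair ((Primrec.const []).pair Primrec.fst)))).and
      (Primrec.nat_lt.comp (Primrec.list_length.comp hp) (Primrec.list_length.comp Primrec.fst))
  have hsearch : Partrec fun x : List Bool => Nat.rfindOpt fun k =>
      if U.OutputsWithin k.unpair.2 (nthString k.unpair.1) [] x ∧
        (nthString k.unpair.1).length < x.length then some () else none :=
    Partrec.rfindOpt (Primrec.ite hP (Primrec.const (some ())) (Primrec.const none)).to_comp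
  refine hsearch.dom_re.of_eq fun x => ?_
  rw [mem_compl_randomStrings_iff, Nat.rfindOpt_dom]
  constructor
  · rintro ⟨k, _, hk⟩
    split_ifs at hk with h
    · exact ⟨_, ⟨_, h.1⟩, h.2⟩
    · cases hk
  · rintro ⟨p, ⟨T, hT⟩, hlen⟩
    exact ⟨Nat.pair (strIndex p) T, (), by simp [nthString_strIndex, hT, hlen]⟩

end TuringMachine

/-! ### Computing hitting sets for the outputs of short programs -/

/-- `X` has at most `2 ^ s` members and hits each member of `C` that has at least `2 ^ (m - e)`
members. -/
def IsHitting (e s m : ℕ) (C : List (List ℕ)) (X : List ℕ) : Prop :=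
  X.length ≤ 2 ^ s ∧ ∀ Z ∈ C, 2 ^ m ≤ 2 ^ e * Z.length → ∃ i ∈ Z, i ∈ X

theorem exists_isHitting {e s m r : ℕ} (he : 1 ≤ e) (hes : e ≤ s) (hr : r < 2 ^ (s - e))
    (C : List (List ℕ)) (hlen : C.length ≤ 2 ^ r) (hnodup : ∀ Z ∈ C, Z.Nodup)
    (hlt : ∀ Z ∈ C, ∀ i ∈ Z, i < 2 ^ m) : ∃ X, IsHitting e s m C X := by
  have hpos : 2 ^ e - 1 + 1 = 2 ^ e := Nat.sub_add_cancel (Nat.two_pow_pos e)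
  set D := (C.filter fun Z => 2 ^ m ≤ 2 ^ e * Z.length).map List.toFinset with hD
  have hmem : ∀ W ∈ D, ∃ Z ∈ C, 2 ^ m ≤ 2 ^ e * Z.length ∧ Z.toFinset = W := by
    intro W hW
    obtain ⟨Z, hZ, rfl⟩ := List.mem_map.mp hW
    obtain ⟨hZ, hZd⟩ := List.mem_filter.mp hZ
    exact ⟨Z, hZ, of_decide_eq_true hZd, rfl⟩
  obtain ⟨X, hX, hhit⟩ := exists_hitting_list (a := 2 ^ e - 1) (Nat.two_pow_pos m) (2 ^ s) D
    (fun W hW i hi => by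
      obtain ⟨Z, hZ, -, rfl⟩ := hmem W hW
      exact Finset.mem_range.mpr (hlt Z hZ i (List.mem_toFinset.mp hi)))
    (fun W hW => by
      obtain ⟨Z, hZ, hd, rfl⟩ := hmem W hW
      rwa [List.toFinset_card_of_nodup (hnodup Z hZ), hpos])
    (by
      rw [hpos]
      refine lt_of_le_of_lt (Nat.mul_le_mul_right _ ?_) (two_pow_mul_pow_lt he hes hr)
      rw [hD, List.length_map]
      exact (List.length_filter_le _ _).trans hlen)
  refine ⟨X, hX, fun Z hZ hd => ?_⟩
  obtain ⟨i, hi, hiX⟩ := hhit Z.toFinset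
    (List.mem_map.mpr ⟨Z, List.mem_filter.mpr ⟨hZ, decide_eq_true hd⟩, rfl⟩)
  exact ⟨i, List.mem_toFinset.mp hi, hiX⟩

theorem primrecPred_isHitting (e : ℕ) :
    PrimrecPred fun a : (ℕ × ℕ × List (List ℕ)) × List ℕ =>
      IsHitting e a.1.1 a.1.2.1 a.1.2.2 a.2 := by
  have hmem : PrimrecRel fun (i : ℕ) (X : List ℕ) => i ∈ X :=
    ((PrimrecRel.exists_mem_list (Primrec.eq (α := ℕ))).swap).of_eq fun i X => by simp
  have hZX : PrimrecRel fun (Z : List ℕ) (b : ℕ × List ℕ) =>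
      2 ^ b.1 ≤ 2 ^ e * Z.length → ∃ i ∈ Z, i ∈ b.2 := by
    refine PrimrecPred.of_eq (PrimrecPred.or (PrimrecPred.not (Primrec.nat_le.comp
      (primrec_two_pow.comp (Primrec.fst.comp Primrec.snd))
      (Primrec.nat_mul.comp (Primrec.const (2 ^ e)) (Primrec.list_length.comp Primrec.fst))))
      ((PrimrecRel.exists_mem_list hmem).comp Primrec.fst (Primrec.snd.comp Primrec.snd)))
      fun a => ?_
    exact imp_iff_not_or.symm
  have h₁ : PrimrecPred fun a : (ℕ × ℕ × List (List ℕ)) × List ℕ => a.2.length ≤ 2 ^ a.1.1 :=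
    Primrec.nat_le.comp (Primrec.list_length.comp Primrec.snd)
      (primrec_two_pow.comp (Primrec.fst.comp Primrec.fst))
  exact h₁.and ((PrimrecRel.forall_mem_list hZX).comp
    (Primrec.snd.comp (Primrec.snd.comp Primrec.fst))
    ((Primrec.fst.comp (Primrec.snd.comp Primrec.fst)).pair Primrec.snd))

open scoped Classical in
/-- The first hitting list in an enumeration of all lists. -/
noncomputable def hittingSearch (e : ℕ) (a : ℕ × ℕ × List (List ℕ)) : Part (List ℕ) :=
  Nat.rfindOpt fun k => (Encodable.decode k : Option (List ℕ)).bind fun X =>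
    if IsHitting e a.1 a.2.1 a.2.2 X then some X else none

theorem partrec_hittingSearch (e : ℕ) : Partrec (hittingSearch e) := by
  classical
  refine Partrec.rfindOpt (Primrec.to_comp ?_)
  refine Primrec.option_bind (Primrec.decode.comp Primrec.snd) (Primrec.ite ?_ ?_ ?_)
  · exact (primrecPred_isHitting e).comp ((Primrec.fst.comp Primrec.fst).pair Primrec.snd)
  · exact Primrec.option_some.comp Primrec.snd
  · exact Primrec.const none

theorem exists_mem_hittingSearch {e s m : ℕ} {C : List (List ℕ)} (h : ∃ X, IsHitting e s m C X) :
    ∃ X ∈ hittingSearch e (s, m, C), IsHitting e s m C X := by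
  classical
  obtain ⟨X, hX⟩ := h
  have hdom : (hittingSearch e (s, m, C)).Dom :=
    Nat.rfindOpt_dom.mpr ⟨Encodable.encode X, X, by simp [hX]⟩
  obtain ⟨Y, hY⟩ := Part.dom_iff_mem.mp hdom
  refine ⟨Y, hY, ?_⟩
  obtain ⟨k, hk⟩ := Nat.rfindOpt_spec hY
  obtain ⟨W, -, hW⟩ := Option.bind_eq_some_iff.mp hk
  split_ifs at hW with hh
  cases hW
  exact hh

/-- The numbers `i < 2 ^ m` for which the half-tape `l`, read as a characteristic sequence, excludes
the `i`-th string of length `m`. -/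
def excluded {a : ℕ} (m : ℕ) (l : List (TapeSymbol a)) : List ℕ :=
  (List.range (2 ^ m)).filter fun i => l.getI (2 ^ m - 1 + i) = TapeSymbol.bit false

theorem primrec_excluded {a : ℕ} : Primrec₂ (excluded (a := a)) := by
  have hR : PrimrecRel fun (i : ℕ) (b : ℕ × List (TapeSymbol a)) =>
      b.2.getI (2 ^ b.1 - 1 + i) = TapeSymbol.bit false :=
    Primrec.eq.comp (Primrec.list_getI.comp (Primrec.snd.comp Primrec.snd)
      (Primrec.nat_add.comp (Primrec.nat_sub.comp
        (primrec_two_pow.comp (Primrec.fst.comp Primrec.snd)) (Primrec.const 1)) Primrec.fst))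
      (Primrec.const _)
  exact hR.listFilter.comp (Primrec.list_range.comp (primrec_two_pow.comp Primrec.fst))
    Primrec.id

theorem computable_sum_range {t : ℕ → ℕ} (ht : Computable t) :
    Computable fun N => ∑ n ∈ Finset.range N, t n := by
  refine (Computable.nat_rec (f := fun N : ℕ => N) (g := fun _ => 0)
    (h := fun _ b => b.2 + t b.1) Computable.id (Computable.const 0) ?_).of_eq fun N => ?_
  · exact Primrec.nat_add.to_comp.comp (Computable.snd.comp Computable.snd)
      (ht.comp (Computable.fst.comp Computable.snd))
  · induction N with
    | zero => rfl
    | succ N ih => rw [Finset.sum_range_succ, ← ih]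

theorem computable_comp_triple {α β γ δ σ : Type*} [Primcodable α] [Primcodable β] [Primcodable γ]
    [Primcodable δ] [Primcodable σ] {F : β → γ → δ → σ} {f : α → β} {g : α → γ} {h : α → δ}
    (hF : Computable fun b : β × γ × δ => F b.1 b.2.1 b.2.2) (hf : Computable f)
    (hg : Computable g) (hh : Computable h) : Computable fun a => F (f a) (g a) (h a) :=
  hF.comp (hf.pair (hg.pair hh))

namespace TuringMachine

variable (U : TuringMachine)

/-- The sets of strings of length `m` that are excluded by the outputs, within `T` steps, of the
programs of length less than `L`, where the side information is any number below `2 ^ (m + 2)`. -/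
def candidates (m L T : ℕ) : List (List ℕ) :=
  (List.range (2 ^ (m + 2))).flatMap fun n => (List.range (2 ^ L)).map fun k =>
    excluded m ((U.outTape T (nthString k) (binaryString n)).getD [])

theorem primrec_candidates :
    Primrec fun a : ℕ × ℕ × ℕ => U.candidates a.1 a.2.1 a.2.2 := by
  refine Primrec.list_flatMap (Primrec.list_range.comp (primrec_two_pow.comp
    (Primrec.nat_add.comp Primrec.fst (Primrec.const 2)))) ?_
  refine Primrec.list_map (Primrec.list_range.comp (primrec_two_pow.comp
    (Primrec.fst.comp (Primrec.snd.comp Primrec.fst)))) ?_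
  have hin : Primrec fun b : ((ℕ × ℕ × ℕ) × ℕ) × ℕ =>
      (b.1.1.2.2, nthString b.2, binaryString b.1.2) :=
    (Primrec.snd.comp (Primrec.snd.comp (Primrec.fst.comp Primrec.fst))).pair
    ((primrec_nthString.comp Primrec.snd).pair
      (primrec_binaryString.comp (Primrec.snd.comp Primrec.fst)))
  exact primrec_excluded.comp (Primrec.fst.comp (Primrec.fst.comp Primrec.fst))
    (Primrec.option_getD.comp (U.primrec_outTape.comp hin) (Primrec.const []))

theorem length_candidates (m L T : ℕ) : (U.candidates m L T).length = 2 ^ (m + 2 + L) := by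
  simp [candidates, List.length_flatMap, pow_add]

theorem mem_candidates {m L T : ℕ} {Z : List ℕ} : Z ∈ U.candidates m L T ↔
    ∃ n < 2 ^ (m + 2), ∃ k < 2 ^ L,
      excluded m ((U.outTape T (nthString k) (binaryString n)).getD []) = Z := by
  simp [candidates]

/-- The output of the machine that makes a hitting set nonrandom, with the program `0 ^ d 1 q`
parsed into `d` and `q`: for `m = |q| + 2 d + 2`, find a hitting set of at most `2 ^ |q|` strings of
length `m` and output the one with the number `q`. The side information that a candidate was computed
from is not known, and so all candidates for all numbers below `2 ^ (m + 2)` are to be hit; the sum of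
the time bounds for these numbers serves as a common time bound. -/
noncomputable def hittingOutput (e : ℕ) (t : ℕ → ℕ) (d : ℕ) (q : List Bool) : Part (List Bool) :=
  (hittingSearch e (q.length, q.length + 2 * d + 2,
    U.candidates (q.length + 2 * d + 2) (2 ^ (q.length - (e + 1)))
      (∑ n ∈ Finset.range (2 ^ (q.length + 2 * d + 2 + 2)), t n))).map fun X =>
    nthString (2 ^ (q.length + 2 * d + 2) + X.getI (strIndex q - 2 ^ q.length))

theorem partrec_hittingOutput (e : ℕ) {t : ℕ → ℕ} (ht : Computable t) :
    Partrec₂ (U.hittingOutput e t) := by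
  have hs : Primrec fun a : ℕ × List Bool => a.2.length := Primrec.list_length.comp Primrec.snd
  have hm : Primrec fun a : ℕ × List Bool => a.2.length + 2 * a.1 + 2 :=
    Primrec.nat_add.comp (Primrec.nat_add.comp hs (Primrec.nat_double.comp Primrec.fst))
      (Primrec.const 2)
  have hL : Primrec fun a : ℕ × List Bool => 2 ^ (a.2.length - (e + 1)) :=
    primrec_two_pow.comp (Primrec.nat_sub.comp hs (Primrec.const (e + 1)))
  have hT : Computable fun a : ℕ × List Bool =>
      ∑ n ∈ Finset.range (2 ^ (a.2.length + 2 * a.1 + 2 + 2)), t n :=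
    (computable_sum_range ht).comp
      (primrec_two_pow.comp (Primrec.nat_add.comp hm (Primrec.const 2))).to_comp
  have hC : Computable fun a : ℕ × List Bool =>
      U.candidates (a.2.length + 2 * a.1 + 2) (2 ^ (a.2.length - (e + 1)))
        (∑ n ∈ Finset.range (2 ^ (a.2.length + 2 * a.1 + 2 + 2)), t n) :=
    computable_comp_triple (F := U.candidates) U.primrec_candidates.to_comp hm.to_comp hL.to_comp hT
  have hin : Computable fun a : ℕ × List Bool => (a.2.length, a.2.length + 2 * a.1 + 2,
      U.candidates (a.2.length + 2 * a.1 + 2) (2 ^ (a.2.length - (e + 1)))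
        (∑ n ∈ Finset.range (2 ^ (a.2.length + 2 * a.1 + 2 + 2)), t n)) :=
    hs.to_comp.pair (hm.to_comp.pair hC)
  have hv : Primrec fun b : (ℕ × List Bool) × List ℕ => strIndex b.1.2 - 2 ^ b.1.2.length :=
    (Primrec.nat_sub.comp (primrec_strIndex.comp Primrec.snd) (primrec_two_pow.comp hs)).comp
      Primrec.fst
  have hout : Primrec fun b : (ℕ × List Bool) × List ℕ =>
      nthString (2 ^ (b.1.2.length + 2 * b.1.1 + 2) + b.2.getI (strIndex b.1.2 - 2 ^ b.1.2.length)) :=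
    primrec_nthString.comp (Primrec.nat_add.comp (primrec_two_pow.comp (hm.comp Primrec.fst))
      (Primrec.list_getI.comp Primrec.snd hv))
  exact Partrec.map ((partrec_hittingSearch e).comp hin) hout.to_comp.to₂

theorem partrec_hittingMachine (e : ℕ) {t : ℕ → ℕ} (ht : Computable t) :
    Partrec₂ fun (p _ : List Bool) =>
      U.hittingOutput e t (p.takeWhile (!·)).length (p.dropWhile (!·)).tail :=
  (U.partrec_hittingOutput e ht).comp
    (Primrec.list_length.comp ((Primrec.list_takeWhile Primrec.not).comp Primrec.fst)).to_comp
    (Primrec.list_tail.comp ((Primrec.list_dropWhile Primrec.not).comp Primrec.fst)).to_comp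

variable {U}

/-- The strings of a computed hitting set are nonrandom: with the overhead `d` of the machine that
outputs them written into the program `0 ^ d 1 q`, the machine chooses the length `m` so large that
the overhead is paid for. -/
theorem IsUniversal.exists_hitting_nonrandom (hU : U.IsUniversal) {e : ℕ} (he : 1 ≤ e)
    {t : ℕ → ℕ} (ht : Computable t) :
    ∃ d, ∀ s, 2 * e + 2 * d + 7 ≤ s →
      ∃ X, IsHitting e s (s + 2 * d + 2) (U.candidates (s + 2 * d + 2) (2 ^ (s - (e + 1)))
          (∑ n ∈ Finset.range (2 ^ (s + 2 * d + 2 + 2)), t n)) X ∧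
        ∀ i ∈ X, nthString (2 ^ (s + 2 * d + 2) + i) ∉ U.randomStrings := by
  obtain ⟨d, hd⟩ := hU.exists_program (U.partrec_hittingMachine e ht)
  refine ⟨d, fun s hs => ?_⟩
  have hr : s + 2 * d + 2 + 2 + 2 ^ (s - (e + 1)) < 2 ^ (s - e) := by
    have h₁ := add_lt_two_pow (b := e + 2 * d + 5) (j := s - (e + 1)) (by omega)
    have h₂ : s - e = s - (e + 1) + 1 := by omega
    rw [h₂, pow_succ]
    omega
  obtain ⟨X, hX, hhit⟩ := exists_mem_hittingSearch (exists_isHitting he (by omega) hr _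
    (U.length_candidates (s + 2 * d + 2) (2 ^ (s - (e + 1)))
      (∑ n ∈ Finset.range (2 ^ (s + 2 * d + 2 + 2)), t n)).le
    (fun Z hZ => by
      obtain ⟨n, -, k, -, rfl⟩ := U.mem_candidates.mp hZ
      exact List.nodup_range.filter _)
    (fun Z hZ i hi => by
      obtain ⟨n, -, k, -, rfl⟩ := U.mem_candidates.mp hZ
      exact List.mem_range.mp (List.mem_of_mem_filter hi)))
  refine ⟨X, hhit, fun i hi => ?_⟩
  obtain ⟨v, hv, rfl⟩ := List.getElem_of_mem hi
  have hvs : v < 2 ^ s := hv.trans_le hhit.1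
  set q := nthString (2 ^ s + v) with hq
  have hql : q.length = s := length_nthString (by omega) (by rw [pow_succ]; omega)
  have hqv : strIndex q - 2 ^ q.length = v := by
    rw [hql, hq, strIndex_nthString (by omega), Nat.add_sub_cancel_left]
  obtain ⟨p, hp, hlen⟩ := hd (List.replicate d false ++ true :: q)
    (nthString (2 ^ (s + 2 * d + 2) + X[v])) (by
      have h₁ : ((List.replicate d false ++ true :: q).takeWhile (!·)).length = d := by
        rw [List.takeWhile_append_of_pos (by simp)]
        simp
      have h₂ : ((List.replicate d false ++ true :: q).dropWhile (!·)).tail = q := by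
        rw [List.dropWhile_append_of_pos (by simp)]
        simp
      simp only [h₁, h₂, hittingOutput, hqv]
      rw [hql]
      refine (Part.mem_map_iff _).mpr ⟨X, hX, ?_⟩
      rw [List.getI_eq_getElem _ hv])
  refine mem_compl_randomStrings_iff.mpr ⟨p, hp, lt_of_lt_of_le ?_
    (le_length_nthString (m := s + 2 * d + 2) (Nat.le_add_right _ _))⟩
  simp only [List.length_append, List.length_replicate, List.length_cons, hql] at hlen
  omega

open scoped Classical in
theorem charPrefix_getElem?_eq_false_iff {A : Set (List Bool)} {n i : ℕ} (hi : i < n) :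
    (charPrefix A n)[i]? = some false ↔ nthString (i + 1) ∉ A := by
  simp [charPrefix, hi]

open scoped Classical in
/-- A half-tape that holds a long enough prefix of the characteristic sequence of the nonrandom
strings excludes exactly the random strings. -/
theorem excluded_charPrefix {m n : ℕ} (hn : 2 ^ (m + 1) ≤ n + 1)
    {l : List (TapeSymbol U.numAux)}
    (hl : Turing.ListBlank.mk l =
      Turing.ListBlank.mk ((charPrefix U.randomStringsᶜ n).map TapeSymbol.bit)) :
    excluded m l =
      (List.range (2 ^ m)).filter fun i => nthString (2 ^ m + i) ∈ U.randomStrings := by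
  refine List.filter_congr fun i hi => ?_
  have hi := List.mem_range.mp hi
  have hpos := Nat.two_pow_pos m
  rw [pow_succ] at hn
  rw [decide_eq_decide, getI_eq_bit_iff hl, charPrefix_getElem?_eq_false_iff (by omega),
    show 2 ^ m - 1 + i + 1 = 2 ^ m + i by omega, Set.notMem_compl_iff]

/-- A program that outputs a prefix of the characteristic sequence of the nonrandom strings within a
computable time bound has at least linear length. -/
theorem IsUniversal.linear_le_length (hU : U.IsUniversal) {t : ℕ → ℕ} (ht : Computable t) :
    ∃ c N, 0 < c ∧ ∀ n, N ≤ n → ∀ p,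
      U.OutputsWithin (t n) p (binaryString n) (charPrefix U.randomStringsᶜ n) →
        n ≤ c * p.length := by
  classical
  obtain ⟨e, he, hrand⟩ := hU.exists_card_random
  obtain ⟨d, hd⟩ := hU.exists_hitting_nonrandom he ht
  -- With `m = s + 2 * d + 2` and `n < 2 ^ (m + 2)`, the first constant makes programs `p` with
  -- `c * |p| < n` shorter than `2 ^ (s - (e + 1))`. The second makes `s` large enough for the
  -- hitting set.
  refine ⟨2 ^ (2 * d + 5 + e), 2 ^ (2 * e + 4 * d + 10), Nat.two_pow_pos _, fun n hn p hp => ?_⟩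
  by_contra! hlt
  -- `s + 2 * d + 2` is the largest length whose strings are all covered by the prefix.
  obtain ⟨s, hs⟩ : ∃ s, Nat.log 2 (n + 1) = s + 2 * d + 3 := by
    have : 2 * e + 4 * d + 10 ≤ Nat.log 2 (n + 1) :=
      (Nat.le_log_iff_pow_le (by norm_num) (by omega)).mpr (by omega)
    exact ⟨Nat.log 2 (n + 1) - (2 * d + 3), by omega⟩
  have hn₁ : 2 ^ (s + 2 * d + 2 + 1) ≤ n + 1 := by
    have := Nat.pow_log_le_self 2 (x := n + 1) (by omega)
    rwa [hs] at this
  have hn₂ : n + 1 < 2 ^ (s + 2 * d + 2 + 2) := by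
    have := Nat.lt_pow_succ_log_self (b := 2) (by norm_num) (n + 1)
    rwa [hs] at this
  have hs_large : 2 * e + 2 * d + 7 ≤ s := by
    have := (Nat.pow_lt_pow_iff_right (by norm_num : 1 < 2)).mp (hn.trans_lt (by omega :
      n < 2 ^ (s + 2 * d + 2 + 2)))
    omega
  obtain ⟨X, ⟨-, hhit⟩, hX⟩ := hd s hs_large
  have hT : t n ≤ ∑ k ∈ Finset.range (2 ^ (s + 2 * d + 2 + 2)), t k :=
    Finset.single_le_sum (f := t) (fun _ _ => Nat.zero_le _) (Finset.mem_range.mpr (by omega))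
  obtain ⟨l, hl, hlx⟩ := (U.outputsWithin_iff _ _ _ _).mp (hp.mono hT)
  have hplen : p.length < 2 ^ (s - (e + 1)) := by
    refine lt_of_mul_lt_mul_left (a := 2 ^ (2 * d + 5 + e)) (hlt.trans ?_) (Nat.zero_le _)
    rw [← pow_add, show 2 * d + 5 + e + (s - (e + 1)) = s + 2 * d + 2 + 2 by omega]
    omega
  have hexcl := excluded_charPrefix hn₁ hlx
  obtain ⟨i, hi, hiX⟩ := hhit (excluded (s + 2 * d + 2) l)
    (U.mem_candidates.mpr ⟨n, by omega, strIndex p,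
      (strIndex_lt_two_pow p).trans_le (Nat.pow_le_pow_right (by norm_num) hplen), by
      rw [nthString_strIndex, hl, Option.getD_some]⟩)
    (by
      refine (hrand (s + 2 * d + 2) (by omega)).trans_eq ?_
      rw [hexcl, ← List.toFinset_card_of_nodup (List.nodup_range.filter _)]
      congr 2
      ext i
      simp)
  rw [hexcl] at hi
  exact hX i hiX (of_decide_eq_true (List.mem_filter.mp hi).2)

end TuringMachine

theorem mainTheorem2 (U : TuringMachine) (hU : U.IsUniversal) :
    REPred (fun x : List Bool => x ∈ U.randomStringsᶜ) ∧
    ∀ t : ℕ → ℕ, Computable t →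
      ∃ c : ℕ, 0 < c ∧ ∀ n : ℕ,
        (n : ℕ∞) ≤ c * U.condKt t (charPrefix U.randomStringsᶜ n) (binaryString n) ∨
        (n < c ∧ U.condKt t (charPrefix U.randomStringsᶜ n) (binaryString n) = 0) := by
  refine ⟨U.rePred_compl_randomStrings, fun t ht => ?_⟩
  obtain ⟨c, N, hc, hlin⟩ := hU.linear_le_length ht
  refine ⟨max c N, lt_max_of_lt_left hc, fun n => ?_⟩
  have hprefix : (charPrefix U.randomStringsᶜ n).length = n := by simp [charPrefix]
  cases hK : U.condKt t (charPrefix U.randomStringsᶜ n) (binaryString n) with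
  | top =>
    left
    rw [ENat.mul_top (by exact_mod_cast (lt_max_of_lt_left hc).ne')]
    exact le_top
  | coe k =>
    have hlt : U.condKt t (charPrefix U.randomStringsᶜ n) (binaryString n) < ((k + 1 : ℕ) : ℕ∞) := by
      rw [hK]
      exact_mod_cast Nat.lt_succ_self k
    obtain ⟨p, hp, hpk⟩ := descComplexity_lt_iff.mp hlt
    rw [hprefix] at hp
    have hpk := Nat.cast_lt.mp hpk
    rcases le_or_gt (max c N) n with hn | hn
    · left
      have h₁ := hlin n ((le_max_right c N).trans hn) p hp
      have h₂ : c * p.length ≤ max c N * k := Nat.mul_le_mul (le_max_left c N) (by omega)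
      exact_mod_cast h₁.trans h₂
    · rcases Nat.eq_zero_or_pos k with rfl | hk
      · exact Or.inr ⟨hn, rfl⟩
      · left
        have : n ≤ max c N * k := hn.le.trans (Nat.le_mul_of_pos_right _ hk)
        exact_mod_cast this
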